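/- Let $N\in\mathbb{N}$ and let $R_1,R_2$ be independent random elements of $SU(N)$ whose distributions are supported on the whole group (every non-empty open subset of $SU(N)$ has positive probability) and are absolutely continuous with respect to the Haar measure of $SU(N)$; for instance, distributions whose densities are non-zero on the whole group. Then, with probability $1$, the set $$\Big\{\prod_{i=1}^{k} R_1^{p_i}R_2^{q_i}\ \Big|\ k\in\mathbb{N},\ p_i,q_i\in\mathbb{Z}\Big\},$$ that is, the subgroup generated by $R_1$ and $R_2$, is dense in $SU(N)$. -/

import Mathlib

open MeasureTheory

/-- The compact group `SU(N)` of complex unitary `N × N` matrices of determinant one, with its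
matrix multiplication, the topology induced from the entries, and the Borel structure. -/
abbrev SU (N : ℕ) : Type := Matrix.specialUnitaryGroup (Fin N) ℂ

instance SU.instIsTopologicalGroup (N : ℕ) : IsTopologicalGroup (SU N) where
  continuous_mul := by fun_prop
  continuous_inv := by
    refine Continuous.subtype_mk (f := fun A : SU N => star (A : Matrix (Fin N) (Fin N) ℂ)) ?_ _
    fun_prop

/-- `SU(N)` is bounded and closed, hence compact. -/
instance SU.instCompactSpace (N : ℕ) : CompactSpace (SU N) := by
  refine isCompact_iff_compactSpace (X := Matrix (Fin N) (Fin N) ℂ)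
    (s := (Matrix.specialUnitaryGroup (Fin N) ℂ : Set (Matrix (Fin N) (Fin N) ℂ))).1 ?_
  have hK : IsCompact (Set.univ.pi fun _ : Fin N => Set.univ.pi fun _ : Fin N =>
      Metric.closedBall (0 : ℂ) 1) :=
    isCompact_univ_pi fun _ => isCompact_univ_pi fun _ => isCompact_closedBall 0 1
  refine IsCompact.of_isClosed_subset (X := Matrix (Fin N) (Fin N) ℂ) hK ?_ ?_
  · have h : ((Matrix.specialUnitaryGroup (Fin N) ℂ : Submonoid (Matrix (Fin N) (Fin N) ℂ)) :
        Set (Matrix (Fin N) (Fin N) ℂ)) = {A | A * star A = 1} ∩ {A | A.det = 1} := by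
      ext A
      simp [Matrix.mem_specialUnitaryGroup_iff, Matrix.mem_unitaryGroup_iff]
    rw [h]
    refine (isClosed_eq ?_ continuous_const).inter (isClosed_eq ?_ continuous_const)
    · fun_prop
    · fun_prop
  · intro A hA i _ j _
    simpa using entry_norm_bound_of_unitary
      ((Matrix.mem_specialUnitaryGroup_iff.1 hA).1) i j

noncomputable instance SU.instMeasurableSpace (N : ℕ) : MeasurableSpace (SU N) := borel (SU N)

instance SU.instBorelSpace (N : ℕ) : BorelSpace (SU N) := ⟨rfl⟩

/-- The set of all finite products `∏_{i=1}^k a ^ pᵢ * b ^ qᵢ` (taken in increasing order of `i`)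
with `k ∈ ℕ` and integers `pᵢ`, `qᵢ`. -/
def wordSet {G : Type*} [Group G] (a b : G) : Set G :=
  {g | ∃ (k : ℕ) (p q : Fin k → ℤ), g = (List.ofFn fun i => a ^ p i * b ^ q i).prod}

open scoped Matrix.Norms.L2Operator in
theorem Matrix.exists_isHermitian_exp_eq_of_mem_unitaryGroup {n : Type*} [Fintype n]
    [DecidableEq n] {a : Matrix n n ℂ} (ha : a ∈ Matrix.unitaryGroup n ℂ) :
    ∃ x : Matrix n n ℂ, x.IsHermitian ∧ NormedSpace.exp (Complex.I • x) = a := by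
  have hnormal : IsStarNormal a := ⟨by
    rw [Commute, SemiconjBy, Matrix.mem_unitaryGroup_iff.1 ha, Matrix.mem_unitaryGroup_iff'.1 ha]⟩
  have hcont : ∀ (f : ℂ → ℂ) (s : Set ℂ), s.Finite → ContinuousOn f s := fun f s hs =>
    hs.continuousOn f
  have hfin : (spectrum ℂ a).Finite := Matrix.finite_spectrum a
  refine ⟨cfc (Complex.ofReal ∘ Complex.arg : ℂ → ℂ) a,
    (IsSelfAdjoint.cfc_arg a).isHermitian, ?_⟩
  have hcomp := cfc_comp' (fun z : ℂ => NormedSpace.exp (Complex.I • z))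
    (Complex.ofReal ∘ Complex.arg) a (hcont _ _ (hfin.image _)) (hcont _ _ hfin)
  have hself := IsSelfAdjoint.cfc_arg a
  set b := cfc (Complex.ofReal ∘ Complex.arg : ℂ → ℂ) a
  have hfin' : (spectrum ℂ b).Finite := Matrix.finite_spectrum b
  have hbn : IsStarNormal b := hself.isStarNormal
  rw [← CFC.exp_eq_normedSpace_exp (𝕜 := ℂ) (IsStarNormal.smul _ _),
    ← cfc_comp_smul Complex.I NormedSpace.exp b (hcont _ _ (hfin'.image _)) hbn, ← hcomp]
  · conv_rhs => rw [← cfc_id' ℂ a]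
    refine cfc_congr fun y hy => ?_
    have hy₁ : ‖y‖ = 1 := spectrum.norm_eq_one_of_unitary ha hy
    have h := Complex.norm_mul_exp_arg_mul_I y
    rw [hy₁] at h
    simpa [← Complex.exp_eq_exp_ℂ, mul_comm] using h

theorem Matrix.exists_diagonal_of_mem_unitaryGroup {n : Type*} [Fintype n]
    [DecidableEq n] {a : Matrix n n ℂ} (ha : a ∈ Matrix.unitaryGroup n ℂ) :
    ∃ v ∈ Matrix.unitaryGroup n ℂ, ∃ c : n → ℝ,
      a = v * Matrix.diagonal (fun i => Complex.exp (c i * Complex.I)) * star v := by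
  obtain ⟨x, hx, rfl⟩ := Matrix.exists_isHermitian_exp_eq_of_mem_unitaryGroup ha
  refine ⟨hx.eigenvectorUnitary, hx.eigenvectorUnitary.2, hx.eigenvalues, ?_⟩
  have hu := hx.eigenvectorUnitary.2
  have hinv : (hx.eigenvectorUnitary : Matrix n n ℂ)⁻¹ = star (hx.eigenvectorUnitary : Matrix n n ℂ) :=
    Matrix.inv_eq_right_inv (Matrix.mem_unitaryGroup_iff.1 hu)
  conv_lhs => rw [hx.spectral_theorem, Unitary.conjStarAlgAut_apply]
  rw [← Matrix.smul_mul, ← Matrix.mul_smul, ← hinv, Matrix.exp_conj]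
  · congr 2
    rw [← Matrix.diagonal_smul, Matrix.exp_diagonal]
    congr 1
    ext i
    simp [Pi.coe_exp, Complex.exp_eq_exp_ℂ, mul_comm]
  · exact (Matrix.isUnit_iff_isUnit_det _).2 (Matrix.UnitaryGroup.det_isUnit _)

/-- Every element of `SU(N)` is unitarily conjugate to the exponential of an imaginary diagonal
matrix of trace zero. -/
theorem SU.exists_diagonal {N : ℕ} (a : SU N) :
    ∃ v ∈ Matrix.unitaryGroup (Fin N) ℂ, ∃ c : Fin N → ℝ, ∑ i, c i = 0 ∧
      (a : Matrix (Fin N) (Fin N) ℂ)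
        = v * Matrix.diagonal (fun i => Complex.exp (c i * Complex.I)) * star v := by
  obtain ⟨ha, hdet⟩ := Matrix.mem_specialUnitaryGroup_iff.1 a.2
  obtain ⟨v, hv, c, hc⟩ := Matrix.exists_diagonal_of_mem_unitaryGroup ha
  rcases isEmpty_or_nonempty (Fin N) with hN | ⟨⟨i₀⟩⟩
  · exact ⟨v, hv, c, by simp, hc⟩
  have hprod : Complex.exp ((∑ i, c i : ℝ) * Complex.I) = 1 := by
    have h2 : v.det * (star v).det = 1 := by
      rw [← Matrix.det_mul, Matrix.mem_unitaryGroup_iff.1 hv, Matrix.det_one]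
    rw [hc, Matrix.det_mul, Matrix.det_mul, mul_right_comm, h2, one_mul,
      Matrix.det_diagonal, ← Complex.exp_sum, ← Finset.sum_mul] at hdet
    simpa using hdet
  obtain ⟨k, hk⟩ := Complex.exp_eq_one_iff.1 hprod
  have hk' : ∑ i, c i = k * (2 * Real.pi) := by
    have h3 : ((∑ i, c i : ℝ) : ℂ) = ((k * (2 * Real.pi) : ℝ) : ℂ) := by
      apply mul_right_cancel₀ Complex.I_ne_zero
      rw [hk]; push_cast; ring
    exact_mod_cast h3
  refine ⟨v, hv, fun i => c i - if i = i₀ then k * (2 * Real.pi) else 0, ?_, ?_⟩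
  · rw [Finset.sum_sub_distrib, hk']; simp
  · rw [hc]
    congr 3
    ext i
    dsimp only
    split_ifs with h
    · rw [Complex.exp_eq_exp_iff_exists_int]
      exact ⟨k, by push_cast; ring⟩
    · simp

theorem AnalyticOnNhd.volume_zeros_eq_zero {f : ℝ → ℂ} (hf : AnalyticOnNhd ℝ f Set.univ)
    {x : ℝ} (hx : f x ≠ 0) : volume {t | f t = 0} = 0 := by
  have h := hf.preimage_zero_mem_codiscrete hx
  have h2 := ae_restrict_le_codiscreteWithin (μ := (volume : Measure ℝ)) MeasurableSet.univ h
  rw [Measure.restrict_univ] at h2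
  rw [mem_ae_iff] at h2
  convert h2 using 2
  ext t
  simp

/-- If a closed set `Z` meets each orbit of a one-parameter group of left translations in a null
set of times or in all times, then almost every orbit starting in `Z` stays in `Z`. -/
theorem ae_forall_translate_mem_of_isClosed {G : Type*} [Group G] [TopologicalSpace G]
    [IsTopologicalGroup G] [SecondCountableTopology G] [MeasurableSpace G] [BorelSpace G]
    (μ : Measure G) [SFinite μ] [μ.IsMulLeftInvariant] {Z : Set G} (hZ : IsClosed Z)
    {γ : ℝ → G} (hγ : Continuous γ) (hadd : ∀ s t, γ (s + t) = γ s * γ t)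
    (h : ∀ g, (∀ t, γ t * g ∈ Z) ∨ volume {t | γ t * g ∈ Z} = 0) :
    ∀ᵐ g ∂μ, g ∈ Z → ∀ t, γ t * g ∈ Z := by
  set W : Set G := {g | ∀ t, γ t * g ∈ Z} with hW
  have hWcl : IsClosed W := by
    rw [hW, Set.ofPred_forall]
    exact isClosed_iInter fun t => hZ.preimage (continuous_const.mul continuous_id)
  have hA : MeasurableSet (Z \ W) := hZ.measurableSet.diff hWcl.measurableSet
  have hS : MeasurableSet ((fun p : ℝ × G => γ p.1 * p.2) ⁻¹' (Z \ W)) :=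
    Continuous.measurable (by fun_prop) hA
  have hWinv : ∀ g s, γ s * g ∈ W → g ∈ W := by
    intro g s hg t
    have := hg (t - s)
    rwa [← mul_assoc, ← hadd, sub_add_cancel] at this
  have h1 := Measure.prod_apply (μ := (volume : Measure ℝ)) (ν := μ) hS
  have h2 := Measure.prod_apply_symm (μ := (volume : Measure ℝ)) (ν := μ) hS
  have h3 : ∀ t : ℝ, μ (Prod.mk t ⁻¹' ((fun p : ℝ × G => γ p.1 * p.2) ⁻¹' (Z \ W)))
      = μ (Z \ W) := fun t => measure_preimage_mul μ (γ t) (Z \ W)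
  have h4 : ∀ g : G,
      volume ((fun t => (t, g)) ⁻¹' ((fun p : ℝ × G => γ p.1 * p.2) ⁻¹' (Z \ W))) = 0 := by
    intro g
    rcases h g with hg | hg
    · convert measure_empty (μ := (volume : Measure ℝ))
      ext t
      simp only [Set.mem_preimage, Set.mem_sdiff, Set.mem_empty_iff_false, iff_false, not_and, not_not]
      intro _ s
      rw [← mul_assoc, ← hadd]
      exact hg _
    · exact measure_mono_null (fun t ht => ht.1) hg
  rw [h1, lintegral_congr h3, lintegral_congr h4, lintegral_const, lintegral_zero,
    Real.volume_univ] at h2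
  have h5 : μ (Z \ W) = 0 := by simpa using h2
  refine measure_mono_null (fun g hg => ?_) h5
  simpa [hW] using hg

instance SU.instSecondCountableTopology (N : ℕ) : SecondCountableTopology (SU N) := by
  have : SecondCountableTopology (Matrix (Fin N) (Fin N) ℂ) :=
    inferInstanceAs (SecondCountableTopology (Fin N → Fin N → ℂ))
  exact TopologicalSpace.Subtype.secondCountableTopology
    (Matrix.specialUnitaryGroup (Fin N) ℂ : Set (Matrix (Fin N) (Fin N) ℂ))

/-- `SU(N)` is covered by its real-analytic one-parameter subgroups. -/
theorem SU.exists_oneParameter {N : ℕ} (a : SU N) : ∃ γ : ℝ → SU N, Continuous γ ∧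
    (∀ s t, γ (s + t) = γ s * γ t) ∧ γ 1 = a ∧
    ∀ i j t, AnalyticAt ℝ (fun s => (γ s : Matrix (Fin N) (Fin N) ℂ) i j) t := by
  obtain ⟨v, hv, c, hc, ha⟩ := SU.exists_diagonal a
  have hv' := Matrix.mem_unitaryGroup_iff'.1 hv
  have hv'' := Matrix.mem_unitaryGroup_iff.1 hv
  let δ : ℝ → Matrix (Fin N) (Fin N) ℂ := fun t =>
    v * Matrix.diagonal (fun i => Complex.exp ((t * c i : ℝ) * Complex.I)) * star v
  have hmul : ∀ s t, δ (s + t) = δ s * δ t := by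
    intro s t
    have : δ s * δ t = v * (Matrix.diagonal (fun i => Complex.exp ((s * c i : ℝ) * Complex.I)) *
        (star v * v) * Matrix.diagonal (fun i => Complex.exp ((t * c i : ℝ) * Complex.I)))
        * star v := by
      simp only [δ, Matrix.mul_assoc]
    rw [this, hv', Matrix.mul_one, Matrix.diagonal_mul_diagonal]
    simp only [δ]
    congr 3
    ext i
    rw [← Complex.exp_add]
    congr 1
    push_cast
    ring
  have hstar : ∀ t, star (δ t) = δ (-t) := by
    intro t
    simp only [δ, star_mul, star_star, Matrix.mul_assoc]
    congr 2
    rw [Matrix.star_eq_conjTranspose, Matrix.diagonal_conjTranspose]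
    congr 1
    ext i
    simp [← Complex.exp_conj]
  have h0 : δ 0 = 1 := by simp [δ, hv'']
  have hmem : ∀ t, δ t ∈ Matrix.specialUnitaryGroup (Fin N) ℂ := by
    intro t
    rw [Matrix.mem_specialUnitaryGroup_iff]
    constructor
    · rw [Matrix.mem_unitaryGroup_iff, hstar, ← hmul, add_neg_cancel, h0]
    · have h2 : v.det * (star v).det = 1 := by
        rw [← Matrix.det_mul, hv'', Matrix.det_one]
      simp only [δ]
      rw [Matrix.det_mul, Matrix.det_mul, mul_right_comm, h2, one_mul, Matrix.det_diagonal,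
        ← Complex.exp_sum, ← Finset.sum_mul, ← Complex.ofReal_sum, ← Finset.mul_sum, hc]
      simp
  refine ⟨fun t => ⟨δ t, hmem t⟩, ?_, ?_, ?_, ?_⟩
  · refine Continuous.subtype_mk ?_ _
    simp only [δ]
    fun_prop
  · intro s t
    exact Subtype.ext (hmul s t)
  · refine Subtype.ext ?_
    simp [δ, ha]
  · intro i j t
    have hexp : ∀ (k : Fin N), AnalyticAt ℝ
        (fun s : ℝ => Complex.exp ((s * c k : ℝ) * Complex.I)) t := by
      intro k
      have h1 : AnalyticAt ℝ (fun s : ℝ => ((s * c k : ℝ) : ℂ)) t :=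
        (Complex.ofRealCLM.analyticAt _).comp (analyticAt_id.mul analyticAt_const)
      exact (AnalyticAt.restrictScalars (𝕜 := ℝ) analyticAt_cexp).comp
        (h1.mul analyticAt_const)
    simp only [δ, Matrix.mul_apply, Matrix.diagonal_apply]
    refine Finset.analyticAt_fun_sum _ fun k _ => AnalyticAt.mul ?_ analyticAt_const
    refine Finset.analyticAt_fun_sum _ fun l _ => AnalyticAt.mul analyticAt_const ?_
    split_ifs
    · exact hexp _
    · exact analyticAt_const

/-- A continuous function on `SU(N)` which is real-analytic along real-analytic curves and does
not vanish identically is nonzero almost everywhere. -/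
theorem SU.ae_haar_ne_zero {N : ℕ} {f : SU N → ℂ} (hcont : Continuous f)
    (hf : ∀ γ : ℝ → SU N,
      (∀ i j t, AnalyticAt ℝ (fun s => (γ s : Matrix (Fin N) (Fin N) ℂ) i j) t) →
      ∀ t, AnalyticAt ℝ (fun s => f (γ s)) t)
    {g₀ : SU N} (h₀ : f g₀ ≠ 0) : ∀ᵐ g ∂(Measure.haar : Measure (SU N)), f g ≠ 0 := by
  have hZ : IsClosed {g | f g = 0} := isClosed_eq hcont continuous_const
  have key : ∀ d : SU N, ∀ᵐ g ∂(Measure.haar : Measure (SU N)), f g = 0 → f (d * g) = 0 := by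
    intro d
    obtain ⟨γ, hγ, hadd, h1, hana⟩ := SU.exists_oneParameter d
    have := ae_forall_translate_mem_of_isClosed Measure.haar hZ hγ hadd fun g => by
      have hg : AnalyticOnNhd ℝ (fun s => f (γ s * g)) Set.univ := by
        intro t _
        refine hf (fun s => γ s * g) (fun i j t => ?_) t
        simp only [Submonoid.coe_mul, Matrix.mul_apply]
        exact Finset.analyticAt_fun_sum _ fun k _ => (hana _ _ _).mul analyticAt_const
      by_cases h : ∀ t, f (γ t * g) = 0
      · exact Or.inl h
      · push Not at h
        exact Or.inr (hg.volume_zeros_eq_zero h.choose_spec)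
    filter_upwards [this] with g hg h
    have := hg h 1
    rwa [h1] at this
  obtain ⟨D, hDc, hD⟩ := TopologicalSpace.exists_countable_dense (SU N)
  filter_upwards [(ae_ball_iff hDc).2 fun d _ => key d] with g hg h
  have hcl : IsClosed {d | f (d * g) = 0} :=
    isClosed_eq (hcont.comp (continuous_id.mul continuous_const)) continuous_const
  have huniv : closure D ⊆ {d | f (d * g) = 0} :=
    closure_minimal (fun d hd => hg d hd h) hcl
  rw [hD.closure_eq] at huniv
  refine h₀ ?_
  simpa using huniv (Set.mem_univ (g₀ * g⁻¹))

/-- Integration of continuous functions over a translate of a compact set carrying a finite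
measure, as a continuous linear functional. -/
noncomputable def ContinuousMap.integralCompCLM {X Y : Type*} [TopologicalSpace X] [CompactSpace X]
    [TopologicalSpace Y] [CompactSpace Y] [MeasurableSpace Y] [BorelSpace Y]
    (μ : Measure Y) [IsFiniteMeasure μ] (φ : C(Y, X)) : C(X, ℂ) →L[ℂ] ℂ :=
  LinearMap.mkContinuous
    { toFun := fun f => ∫ y, f (φ y) ∂μ
      map_add' := fun f g => by
        have hi : ∀ f : C(X, ℂ), Integrable (fun y => f (φ y)) μ := fun f =>
          (f.continuous.comp φ.continuous).integrable_of_hasCompactSupport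
            (HasCompactSupport.of_compactSpace _)
        simpa using integral_add (hi f) (hi g)
      map_smul' := fun c f => by
        simpa using integral_const_mul c fun y => f (φ y) } (μ.real Set.univ) fun f => by
    rw [mul_comm]
    exact norm_integral_le_of_norm_le_const (Filter.Eventually.of_forall fun y => f.norm_coe_le_norm _)

theorem ContinuousMap.integralCompCLM_apply {X Y : Type*} [TopologicalSpace X] [CompactSpace X]
    [TopologicalSpace Y] [CompactSpace Y] [MeasurableSpace Y] [BorelSpace Y]
    (μ : Measure Y) [IsFiniteMeasure μ] (φ : C(Y, X)) (f : C(X, ℂ)) :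
    ContinuousMap.integralCompCLM μ φ f = ∫ y, f (φ y) ∂μ := rfl

theorem UnitAddTorus.mFourier_add_apply {d : Type*} [Fintype d] (n : d → ℤ)
    (x y : UnitAddTorus d) :
    mFourier n (x + y) = mFourier n x * mFourier n y := by
  simp [mFourier, fourier_apply, smul_add, AddCircle.toCircle_add, Finset.prod_mul_distrib]

/-- **Kronecker's theorem**: a closed subgroup of a torus on which no nontrivial character is
trivial is the whole torus. -/
theorem UnitAddTorus.eq_top_of_forall_mFourier_eq_one {d : Type*} [Fintype d]
    (K : AddSubgroup (UnitAddTorus d)) (hK : IsClosed (K : Set (UnitAddTorus d)))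
    (h : ∀ n : d → ℤ, (∀ x ∈ K, mFourier n x = 1) → n = 0) : K = ⊤ := by
  have : CompactSpace K := isCompact_iff_compactSpace.1 hK.isCompact
  let _ : MeasurableSpace K := borel K
  have : BorelSpace K := ⟨rfl⟩
  let μ : Measure K := Measure.addHaar
  let φ : UnitAddTorus d → C(K, UnitAddTorus d) := fun w => ⟨fun k => k + w, by fun_prop⟩
  have hzero : ∀ n : d → ℤ, n ≠ 0 → ∫ k : K, mFourier n (k : UnitAddTorus d) ∂μ = 0 := by
    intro n hn
    have := mt (h n) hn
    push Not at this
    obtain ⟨x, hx, hx1⟩ := this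
    have h1 := integral_add_left_eq_self (μ := μ)
      (fun k : K => mFourier n (k : UnitAddTorus d)) ⟨x, hx⟩
    simp only [AddSubgroup.coe_add, mFourier_add_apply] at h1
    rw [integral_const_mul] at h1
    have h2 : (mFourier n x - 1) * ∫ k : K, mFourier n (k : UnitAddTorus d) ∂μ = 0 := by
      rw [sub_mul, h1, one_mul, sub_self]
    exact (mul_eq_zero.1 h2).resolve_left (sub_ne_zero.2 hx1)
  have heq : ∀ w, ContinuousMap.integralCompCLM μ (φ w) = ContinuousMap.integralCompCLM μ (φ 0) := by
    intro w
    refine ContinuousLinearMap.ext_on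
      (Submodule.dense_iff_topologicalClosure_eq_top.2 span_mFourier_closure_eq_top) ?_
    rintro _ ⟨n, rfl⟩
    simp only [ContinuousMap.integralCompCLM_apply, φ, ContinuousMap.coe_mk, mFourier_add_apply,
      integral_mul_const]
    by_cases hn : n = 0
    · simp [hn, mFourier_zero]
    · simp [hzero n hn]
  rw [eq_top_iff]
  intro w _
  by_contra hw
  let f : C(UnitAddTorus d, ℂ) :=
    ⟨fun x => (Metric.infDist x (K : Set (UnitAddTorus d)) : ℂ), by fun_prop⟩
  have h1 := congrArg (fun L => L f) (heq w)
  simp only [ContinuousMap.integralCompCLM_apply, φ, f, ContinuousMap.coe_mk, add_zero] at h1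
  have hne : (K : Set (UnitAddTorus d)).Nonempty := ⟨0, K.zero_mem⟩
  have hpos : ∀ k : K, 0 < Metric.infDist ((k : UnitAddTorus d) + w) (K : Set (UnitAddTorus d)) := by
    intro k
    rw [← hK.notMem_iff_infDist_pos hne]
    intro hk
    exact hw ((K.add_mem_cancel_left k.2).1 hk)
  rw [integral_complex_ofReal, integral_complex_ofReal, Complex.ofReal_inj] at h1
  have h2 : ∫ k : K, Metric.infDist (k : UnitAddTorus d) (K : Set (UnitAddTorus d)) ∂μ = 0 := by
    rw [integral_congr_ae (g := fun _ => (0 : ℝ)), integral_zero]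
    exact Filter.Eventually.of_forall fun k => Metric.infDist_zero_of_mem k.2
  rw [h2] at h1
  have hc : Continuous fun k : K => Metric.infDist ((k : UnitAddTorus d) + w) (K : Set (UnitAddTorus d)) := by
    fun_prop
  exact (hc.integral_pos_of_hasCompactSupport_nonneg_nonzero (HasCompactSupport.of_compactSpace _)
    (fun k => (hpos k).le) (x := 0) (hpos 0).ne').ne' h1

theorem norm_pow_sub_pow_le_of_norm_le_one {R : Type*} [NormedRing R] [NormOneClass R]
    {a b : R} {M : ℝ} (ha : ‖a‖ ≤ 1) {n : ℕ} (hb : ∀ k < n, ‖b ^ k‖ ≤ M) :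
    ‖a ^ n - b ^ n‖ ≤ n * (‖a - b‖ * M) := by
  induction n with
  | zero => simp
  | succ n ih =>
    have h1 : a ^ (n + 1) - b ^ (n + 1) = a * (a ^ n - b ^ n) + (a - b) * b ^ n := by
      rw [pow_succ' a, pow_succ' b]; noncomm_ring
    have h2 := ih fun k hk => hb k (hk.trans n.lt_succ_self)
    calc ‖a ^ (n + 1) - b ^ (n + 1)‖
        ≤ ‖a‖ * ‖a ^ n - b ^ n‖ + ‖a - b‖ * ‖b ^ n‖ := by
          rw [h1]
          exact (norm_add_le _ _).trans (add_le_add (norm_mul_le _ _) (norm_mul_le _ _))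
      _ ≤ 1 * (n * (‖a - b‖ * M)) + ‖a - b‖ * M := by
          gcongr
          · exact hb n n.lt_succ_self
      _ = (n + 1 : ℕ) * (‖a - b‖ * M) := by push_cast; ring

/-- The **Lie–Trotter product formula**, for one-parameter groups of contractions. -/
theorem tendsto_exp_mul_exp_pow {A : Type*} [NormedRing A] [NormOneClass A] [NormedAlgebra ℝ A]
    [CompleteSpace A] (x y : A) (hx : ∀ t : ℝ, ‖NormedSpace.exp (t • x)‖ ≤ 1)
    (hy : ∀ t : ℝ, ‖NormedSpace.exp (t • y)‖ ≤ 1) :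
    Filter.Tendsto (fun n : ℕ => (NormedSpace.exp (((n : ℝ) + 1)⁻¹ • x) *
      NormedSpace.exp (((n : ℝ) + 1)⁻¹ • y)) ^ (n + 1)) Filter.atTop
      (nhds (NormedSpace.exp (x + y))) := by
  let _ : NormedAlgebra ℚ A := NormedAlgebra.restrictScalars ℚ ℝ A
  let f : ℝ → A := fun t => NormedSpace.exp (t • x) * NormedSpace.exp (t • y) -
    NormedSpace.exp (t • (x + y))
  have hf : HasDerivAt f 0 0 := by
    have h := ((hasDerivAt_exp_smul_const (𝕂 := ℝ) x 0).mul
      (hasDerivAt_exp_smul_const (𝕂 := ℝ) y 0)).sub (hasDerivAt_exp_smul_const (𝕂 := ℝ) (x + y) 0)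
    have h0 : NormedSpace.exp ((0 : ℝ) • x) * x * NormedSpace.exp ((0 : ℝ) • y) +
        NormedSpace.exp ((0 : ℝ) • x) * (NormedSpace.exp ((0 : ℝ) • y) * y) -
        NormedSpace.exp ((0 : ℝ) • (x + y)) * (x + y) = 0 := by
      simp only [zero_smul, NormedSpace.exp_zero, one_mul, mul_one, sub_self]
    rw [← h0]
    exact h
  obtain ⟨M, hM⟩ := (isCompact_Icc (a := (0 : ℝ)) (b := 1)).exists_bound_of_continuousOn
    (f := fun t : ℝ => NormedSpace.exp (t • (x + y)))
    (NormedSpace.exp_continuous.comp (continuous_id.smul continuous_const)).continuousOn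
  have hlim := hf.tendsto_slope_zero
  have hf0 : f 0 = 0 := by simp [f]
  simp only [zero_add, hf0, sub_zero] at hlim
  have hseq : Filter.Tendsto (fun n : ℕ => ((n : ℝ) + 1)⁻¹) Filter.atTop (nhdsWithin 0 {0}ᶜ) := by
    rw [tendsto_nhdsWithin_iff]
    refine ⟨by simpa using tendsto_one_div_add_atTop_nhds_zero_nat (𝕜 := ℝ), ?_⟩
    exact Filter.Eventually.of_forall fun n => inv_ne_zero (by positivity)
  have hlim2 := (hlim.comp hseq).norm.mul_const (M)
  rw [norm_zero, zero_mul] at hlim2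
  rw [tendsto_iff_norm_sub_tendsto_zero]
  refine squeeze_zero (fun _ => norm_nonneg _) (fun n => ?_) hlim2
  have hpow : NormedSpace.exp (x + y) = NormedSpace.exp (((n : ℝ) + 1)⁻¹ • (x + y)) ^ (n + 1) := by
    rw [← NormedSpace.exp_nsmul, ← Nat.cast_smul_eq_nsmul ℝ, smul_smul]
    push_cast
    rw [mul_inv_cancel₀ (by positivity), one_smul]
  have hle := norm_pow_sub_pow_le_of_norm_le_one (n := n + 1)
    (a := NormedSpace.exp (((n : ℝ) + 1)⁻¹ • x) * NormedSpace.exp (((n : ℝ) + 1)⁻¹ • y))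
    (b := NormedSpace.exp (((n : ℝ) + 1)⁻¹ • (x + y))) (M := M) ?_ ?_
  · rw [← hpow] at hle
    refine hle.trans (le_of_eq ?_)
    simp only [Function.comp, inv_inv, norm_smul, Real.norm_eq_abs, f]
    rw [abs_of_pos (by positivity : (0 : ℝ) < n + 1)]
    push_cast
    ring
  · exact (norm_mul_le _ _).trans (mul_le_one₀ (hx _) (norm_nonneg _) (hy _))
  · intro k hk
    rw [← NormedSpace.exp_nsmul, ← Nat.cast_smul_eq_nsmul ℝ, smul_smul]
    refine hM _ ⟨by positivity, ?_⟩
    rw [← div_eq_mul_inv, div_le_one (by positivity)]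
    exact_mod_cast hk.le

open scoped Matrix.Norms.L2Operator in
/-- The Lie algebra of a closed submonoid of the unitary group: the matrices generating a
one-parameter group inside it. -/
noncomputable def Matrix.lieSubmodule {n : Type*} [Fintype n] [DecidableEq n]
    (S : Submonoid (Matrix n n ℂ)) (hS : IsClosed (S : Set (Matrix n n ℂ)))
    (hu : S ≤ Matrix.unitaryGroup n ℂ) : Submodule ℝ (Matrix n n ℂ) where
  carrier := {X | ∀ t : ℝ, NormedSpace.exp (t • X) ∈ S}
  zero_mem' := fun t => by simp [S.one_mem]
  smul_mem' := fun c X hX t => by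
    rw [smul_smul]
    exact hX _
  add_mem' := fun {X Y} hX hY t => by
    rcases subsingleton_or_nontrivial (Matrix n n ℂ) with h | h
    · rw [Subsingleton.elim (NormedSpace.exp (t • (X + Y))) 1]
      exact S.one_mem
    rw [smul_add]
    refine hS.mem_of_tendsto (tendsto_exp_mul_exp_pow (t • X) (t • Y) (fun s => ?_) fun s => ?_)
      (Filter.Eventually.of_forall fun n => S.pow_mem (S.mul_mem ?_ ?_) _)
    · rw [smul_smul]
      exact (CStarRing.norm_of_mem_unitary (hu (hX _))).le
    · rw [smul_smul]
      exact (CStarRing.norm_of_mem_unitary (hu (hY _))).le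
    · rw [smul_smul]; exact hX _
    · rw [smul_smul]; exact hY _

theorem Matrix.conj_mem_lieSubmodule {n : Type*} [Fintype n] [DecidableEq n]
    {S : Submonoid (Matrix n n ℂ)} {hS : IsClosed (S : Set (Matrix n n ℂ))}
    {hu : S ≤ Matrix.unitaryGroup n ℂ} {X g : Matrix n n ℂ}
    (hX : X ∈ Matrix.lieSubmodule S hS hu) (hg : g ∈ S) (hg' : star g ∈ S) :
    g * X * star g ∈ Matrix.lieSubmodule S hS hu := by
  intro t
  have hg1 := Matrix.mem_unitaryGroup_iff.1 (hu hg)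
  have hinv : g⁻¹ = star g := Matrix.inv_eq_right_inv hg1
  rw [← Matrix.smul_mul, ← Matrix.mul_smul, ← hinv, Matrix.exp_conj, hinv]
  · exact S.mul_mem (S.mul_mem hg (hX t)) hg'
  · exact (Matrix.isUnit_iff_isUnit_det _).2 (Matrix.isUnit_det_of_right_inverse hg1)

namespace Matrix

variable {n : Type*} [DecidableEq n]

theorem single_add_single_mem_of_phase_invariant {V : Submodule ℝ (Matrix n n ℂ)}
    (hconj : ∀ d : n → ℂ, (∀ i, ‖d i‖ = 1) → ∀ X ∈ V,
      (of fun k l => d k * X k l * star (d l)) ∈ V)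
    {i j : n} (hij : i ≠ j) {Y : Matrix n n ℂ} (hYV : Y ∈ V) (hY : star Y = -Y) (hne : Y i j ≠ 0)
    {X : Matrix n n ℂ} (hX : star X = -X) :
    single i j (X i j) + single j i (X j i) ∈ V := by
  have mask : ∀ (m : n), ∀ Z ∈ V,
      (of fun k l => if (k = m) ↔ (l = m) then 0 else Z k l) ∈ V := by
    intro m Z hZ
    have h1 := hconj (fun k => if k = m then -1 else 1) (fun k => by split_ifs <;> simp) Z hZ
    have h2 := V.smul_mem (1 / 2 : ℝ) (V.sub_mem hZ h1)
    convert h2 using 1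
    ext k l
    by_cases hk : k = m <;> by_cases hl : l = m <;> simp [hk, hl] <;> ring
  have h1 := mask j _ (mask i Y hYV)
  have hskew : ∀ Z : Matrix n n ℂ, star Z = -Z → ∀ k l, Z l k = -star (Z k l) := by
    intro Z hZ k l
    have := congrFun (congrFun hZ l) k
    rw [star_apply, neg_apply] at this
    rw [this, neg_neg]
  obtain ⟨r, w, hw, hrw⟩ : ∃ (r : ℝ) (w : ℂ), ‖w‖ = 1 ∧ r * (w * Y i j) = X i j := by
    by_cases hx : X i j = 0
    · exact ⟨0, 1, by simp, by simp [hx]⟩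
    · have hq : X i j / Y i j ≠ 0 := div_ne_zero hx hne
      have hq' : ((‖X i j / Y i j‖ : ℝ) : ℂ) ≠ 0 := by exact_mod_cast norm_ne_zero_iff.2 hq
      refine ⟨‖X i j / Y i j‖, (X i j / Y i j) / ‖X i j / Y i j‖, ?_, ?_⟩
      · rw [norm_div, Complex.norm_real, norm_norm, div_self (norm_ne_zero_iff.2 hq)]
      · rw [← mul_assoc, mul_div_cancel₀ _ hq', div_mul_cancel₀ _ hne]
  have h2 := V.smul_mem r (hconj (fun k => if k = i then w else 1)
    (fun k => by split_ifs <;> simp [hw]) _ h1)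
  convert h2 using 1
  have hji := hij.symm
  ext k l
  simp only [add_apply, smul_apply, of_apply, single_apply, Complex.real_smul]
  by_cases hki : k = i
  · subst hki
    by_cases hlj : l = j
    · subst hlj
      simp [hij, hji, hrw]
    · by_cases hlk : l = k
      · subst hlk; simp [hij, hji]
      · simp [hij, hji, hlj, hlk, Ne.symm hlj]
  · by_cases hkj : k = j
    · subst hkj
      by_cases hli : l = i
      · subst hli
        rw [hskew X hX l k, hskew Y hY l k, ← hrw]
        simp [hki, hij]
        left
        ring
      · by_cases hlk : l = k
        · subst hlk; simp [hij, hji]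
        · simp [hij, hji, hli, hlk, Ne.symm hli]
    · by_cases hli : l = i
      · subst hli; simp [hij, hji, hki, hkj, Ne.symm hki, Ne.symm hkj]
      · simp [hki, hkj, hli, Ne.symm hki, Ne.symm hkj, Ne.symm hli]

/-- A real subspace of matrices which contains the imaginary diagonal matrices of trace zero, is
stable under conjugation by diagonal unitary matrices and meets every off-diagonal entry contains
all skew-Hermitian matrices of trace zero. -/
theorem mem_of_star_eq_neg_of_trace_eq_zero [Fintype n] {V : Submodule ℝ (Matrix n n ℂ)}
    (hdiag : ∀ c : n → ℝ, ∑ i, c i = 0 → diagonal (fun i => (c i : ℂ) * Complex.I) ∈ V)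
    (hconj : ∀ d : n → ℂ, (∀ i, ‖d i‖ = 1) → ∀ X ∈ V,
      (of fun k l => d k * X k l * star (d l)) ∈ V)
    (hoff : ∀ i j, i ≠ j → ∃ Y ∈ V, star Y = -Y ∧ Y i j ≠ 0)
    {X : Matrix n n ℂ} (hX : star X = -X) (htr : X.trace = 0) : X ∈ V := by
  have hre : ∀ i, X i i = ((X i i).im : ℂ) * Complex.I := by
    intro i
    have := congrFun (congrFun hX i) i
    rw [star_apply, neg_apply] at this
    have h1 := congrArg Complex.re this
    simp at h1
    apply Complex.ext
    · simp; linarith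
    · simp
  have h1 : diagonal (fun i => X i i) ∈ V := by
    have h2 := hdiag (fun i => (X i i).im) ?_
    · convert h2 using 2
      ext i
      exact hre i
    · have := congrArg Complex.im htr
      simpa [trace] using this
  have h2 : ∑ i, ∑ j, (if i = j then 0 else single i j (X i j) + single j i (X j i)) ∈ V := by
    refine V.sum_mem fun i _ => V.sum_mem fun j _ => ?_
    split_ifs with hij
    · exact V.zero_mem
    · obtain ⟨Y, hYV, hY, hne⟩ := hoff i j hij
      exact single_add_single_mem_of_phase_invariant hconj hij hYV hY hne hX
  have h3 := V.add_mem h1 (V.smul_mem (1 / 2 : ℝ) h2)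
  let M : Matrix n n ℂ := of fun i j => if i = j then 0 else X i j
  have h4 : ∑ i, ∑ j, (if i = j then 0 else single i j (X i j) + single j i (X j i)) = M + M := by
    have h5 : ∑ i, ∑ j, single j i (M j i) = M := by
      rw [Finset.sum_comm]
      exact (matrix_eq_sum_single M).symm
    conv_rhs =>
      congr
      · rw [matrix_eq_sum_single M]
      · rw [← h5]
    simp only [← Finset.sum_add_distrib]
    refine Finset.sum_congr rfl fun i _ => Finset.sum_congr rfl fun j _ => ?_
    by_cases hij : i = j
    · simp [M, hij]
    · simp [M, hij, Ne.symm hij]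
  rw [h4] at h3
  convert h3 using 1
  ext k l
  by_cases hkl : k = l
  · simp [M, hkl]
  · simp [M, hkl]; ring

end Matrix

/-- The submonoid of matrices whose conjugate by `v` lies in a given subgroup of `SU(N)`. -/
def SU.conjSubmonoid {N : ℕ} (H : Subgroup (SU N)) {v : Matrix (Fin N) (Fin N) ℂ}
    (hv : v ∈ Matrix.unitaryGroup (Fin N) ℂ) : Submonoid (Matrix (Fin N) (Fin N) ℂ) where
  carrier := {M | ∃ h ∈ H, (h : Matrix (Fin N) (Fin N) ℂ) = v * M * star v}
  one_mem' := ⟨1, H.one_mem, by simp [Matrix.mem_unitaryGroup_iff.1 hv]⟩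
  mul_mem' := by
    rintro M M' ⟨h, hh, e⟩ ⟨h', hh', e'⟩
    refine ⟨h * h', H.mul_mem hh hh', ?_⟩
    rw [Submonoid.coe_mul, e, e']
    calc v * M * star v * (v * M' * star v) = v * M * (star v * v) * M' * star v := by
          simp only [Matrix.mul_assoc]
      _ = v * (M * M') * star v := by
          rw [Matrix.mem_unitaryGroup_iff'.1 hv, Matrix.mul_one, Matrix.mul_assoc v]

namespace SU

variable {N : ℕ} {H : Subgroup (SU N)} {v : Matrix (Fin N) (Fin N) ℂ}
  {hv : v ∈ Matrix.unitaryGroup (Fin N) ℂ}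

theorem star_mul_mul_mem_conjSubmonoid {h : SU N} (hh : h ∈ H) :
    star v * (h : Matrix (Fin N) (Fin N) ℂ) * v ∈ conjSubmonoid H hv := by
  refine ⟨h, hh, ?_⟩
  have h1 := Matrix.mem_unitaryGroup_iff.1 hv
  calc (h : Matrix (Fin N) (Fin N) ℂ) = (v * star v) * h * (v * star v) := by simp [h1]
    _ = _ := by simp only [Matrix.mul_assoc]

theorem conjSubmonoid_le_unitaryGroup : conjSubmonoid H hv ≤ Matrix.unitaryGroup (Fin N) ℂ := by
  rintro M ⟨h, -, e⟩
  have h1 := Matrix.mem_unitaryGroup_iff'.1 hv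
  have h2 : M = star v * (h : Matrix (Fin N) (Fin N) ℂ) * v := by
    rw [e]
    calc M = (star v * v) * M * (star v * v) := by simp [h1]
      _ = _ := by simp only [Matrix.mul_assoc]
  rw [h2]
  exact mul_mem (mul_mem (Unitary.star_mem hv) (Matrix.mem_specialUnitaryGroup_iff.1 h.2).1) hv

theorem star_mem_conjSubmonoid {M : Matrix (Fin N) (Fin N) ℂ} (hM : M ∈ conjSubmonoid H hv) :
    star M ∈ conjSubmonoid H hv := by
  obtain ⟨h, hh, e⟩ := hM
  refine ⟨h⁻¹, H.inv_mem hh, ?_⟩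
  change star (h : Matrix (Fin N) (Fin N) ℂ) = _
  rw [e]
  simp only [star_mul, star_star, Matrix.mul_assoc]

theorem isClosed_conjSubmonoid (hH : IsClosed (H : Set (SU N))) :
    IsClosed (conjSubmonoid H hv : Set (Matrix (Fin N) (Fin N) ℂ)) := by
  have h1 : IsClosed ((fun h : SU N => (h : Matrix (Fin N) (Fin N) ℂ)) '' (H : Set (SU N))) :=
    (hH.isCompact.image continuous_subtype_val).isClosed
  exact h1.preimage (f := fun M => v * M * star v) (by fun_prop)

/-- A closed subgroup of `SU(N)` containing a maximal torus and an element which mixes all the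
eigenspaces of that torus is the whole group. -/
theorem eq_top_of_torus_le (hH : IsClosed (H : Set (SU N)))
    (hv : v ∈ Matrix.unitaryGroup (Fin N) ℂ)
    (htorus : ∀ c : Fin N → ℝ, ∑ i, c i = 0 → ∃ h ∈ H, (h : Matrix (Fin N) (Fin N) ℂ)
      = v * Matrix.diagonal (fun i => Complex.exp (c i * Complex.I)) * star v)
    {b : SU N} (hb : b ∈ H)
    (hoff : ∀ i j, i ≠ j → ∃ c : Fin N → ℝ, ∑ i, c i = 0 ∧
      (star v * (b : Matrix (Fin N) (Fin N) ℂ) * v * Matrix.diagonal (fun i => (c i : ℂ)) *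
        star (star v * (b : Matrix (Fin N) (Fin N) ℂ) * v)) i j ≠ 0) : H = ⊤ := by
  set S := conjSubmonoid H hv
  have hS : IsClosed (S : Set (Matrix (Fin N) (Fin N) ℂ)) := isClosed_conjSubmonoid hH
  have hu : S ≤ Matrix.unitaryGroup (Fin N) ℂ := conjSubmonoid_le_unitaryGroup
  have hD : ∀ c : Fin N → ℝ, ∑ i, c i = 0 →
      Matrix.diagonal (fun i => Complex.exp (c i * Complex.I)) ∈ S := fun c hc => htorus c hc
  have hexp : ∀ (c : Fin N → ℝ) (t : ℝ),
      NormedSpace.exp (t • Matrix.diagonal (fun i => (c i : ℂ) * Complex.I)) =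
      Matrix.diagonal (fun i => Complex.exp ((t * c i : ℝ) * Complex.I)) := by
    intro c t
    rw [← Matrix.diagonal_smul, Matrix.exp_diagonal]
    congr 1
    ext i
    simp [Pi.coe_exp, Complex.exp_eq_exp_ℂ, mul_assoc]
  have hdiag : ∀ c : Fin N → ℝ, ∑ i, c i = 0 →
      Matrix.diagonal (fun i => (c i : ℂ) * Complex.I) ∈ Matrix.lieSubmodule S hS hu := by
    intro c hc t
    rw [hexp]
    exact hD (fun i => t * c i) (by rw [← Finset.mul_sum, hc, mul_zero])
  have hstarI : ∀ (β : Matrix (Fin N) (Fin N) ℂ) (c : Fin N → ℝ),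
      star (β * Matrix.diagonal (fun i => (c i : ℂ) * Complex.I) * star β) =
      -(β * Matrix.diagonal (fun i => (c i : ℂ) * Complex.I) * star β) := by
    intro β c
    have : star (Matrix.diagonal (fun i => (c i : ℂ) * Complex.I)) =
        -Matrix.diagonal (fun i => (c i : ℂ) * Complex.I) := by
      rw [Matrix.star_eq_conjTranspose, Matrix.diagonal_conjTranspose]
      ext i j
      by_cases hij : i = j <;> simp [hij]
    rw [star_mul, star_mul, star_star, this]
    simp only [Matrix.neg_mul, Matrix.mul_neg, Matrix.mul_assoc]
  have hall : ∀ X : Matrix (Fin N) (Fin N) ℂ, star X = -X → X.trace = 0 →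
      X ∈ Matrix.lieSubmodule S hS hu := by
    intro X hX htr
    refine Matrix.mem_of_star_eq_neg_of_trace_eq_zero hdiag ?_ ?_ hX htr
    · intro d hd X hX
      let θ : Fin N → ℝ := fun i => (d i).arg
      have hdθ : ∀ i, d i = Complex.exp (θ i * Complex.I) := fun i => by
        have := Complex.norm_mul_exp_arg_mul_I (d i)
        rw [hd] at this
        simpa using this.symm
      let m : ℝ := (∑ i, θ i) / N
      have hc : ∑ i, (θ i - m) = 0 := by
        rcases Nat.eq_zero_or_pos N with rfl | hN
        · simp
        · simp only [m, Finset.sum_sub_distrib, Finset.sum_const, Finset.card_univ,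
            Fintype.card_fin, nsmul_eq_mul]
          field_simp
          ring
      have h1 := Matrix.conj_mem_lieSubmodule hX (hD _ hc) (star_mem_conjSubmonoid (hD _ hc))
      convert h1 using 1
      ext k l
      rw [Matrix.star_eq_conjTranspose, Matrix.diagonal_conjTranspose, Matrix.mul_diagonal,
        Matrix.diagonal_mul, Matrix.of_apply, hdθ, hdθ]
      simp only [Pi.star_apply, Complex.star_def, ← Complex.exp_conj, map_mul, Complex.conj_ofReal,
        Complex.conj_I]
      rw [mul_right_comm, ← Complex.exp_add, mul_right_comm, ← Complex.exp_add]
      congr 2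
      push_cast
      ring
    · intro i j hij
      obtain ⟨c, hc, hne⟩ := hoff i j hij
      have hβ : star v * (b : Matrix (Fin N) (Fin N) ℂ) * v ∈ S := star_mul_mul_mem_conjSubmonoid hb
      refine ⟨_, Matrix.conj_mem_lieSubmodule (hdiag c hc) hβ (star_mem_conjSubmonoid hβ),
        hstarI _ c, ?_⟩
      have : Matrix.diagonal (fun i => (c i : ℂ) * Complex.I) =
          Complex.I • Matrix.diagonal (fun i => (c i : ℂ)) := by
        rw [← Matrix.diagonal_smul]
        congr 1
        ext i
        simp [mul_comm]
      rw [this, Matrix.mul_smul, Matrix.smul_mul, Matrix.smul_apply, smul_eq_mul]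
      exact mul_ne_zero Complex.I_ne_zero hne
  rw [eq_top_iff]
  intro g _
  have hv' := Matrix.mem_unitaryGroup_iff'.1 hv
  have hv'' := Matrix.mem_unitaryGroup_iff.1 hv
  have hg' : star v * (g : Matrix (Fin N) (Fin N) ℂ) * v ∈
      Matrix.specialUnitaryGroup (Fin N) ℂ := by
    rw [Matrix.mem_specialUnitaryGroup_iff]
    refine ⟨mul_mem (mul_mem (Unitary.star_mem hv)
      (Matrix.mem_specialUnitaryGroup_iff.1 g.2).1) hv, ?_⟩
    rw [Matrix.det_mul, Matrix.det_mul, (Matrix.mem_specialUnitaryGroup_iff.1 g.2).2, mul_one,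
      ← Matrix.det_mul, hv', Matrix.det_one]
  obtain ⟨u, hu', c, hc, hgu⟩ := SU.exists_diagonal ⟨_, hg'⟩
  have hu1 := Matrix.mem_unitaryGroup_iff.1 hu'
  have hu2 := Matrix.mem_unitaryGroup_iff'.1 hu'
  have hX := hall (u * Matrix.diagonal (fun i => (c i : ℂ) * Complex.I) * star u) (hstarI u c) (by
    rw [Matrix.trace_mul_comm, ← Matrix.mul_assoc, hu2, Matrix.one_mul, Matrix.trace_diagonal,
      ← Finset.sum_mul, ← Complex.ofReal_sum, hc]
    simp) 1
  have hinv : u⁻¹ = star u := Matrix.inv_eq_right_inv hu1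
  rw [← Matrix.smul_mul, ← Matrix.mul_smul, ← hinv, Matrix.exp_conj, hinv, hexp] at hX
  · simp only [one_mul] at hX
    rw [← hgu] at hX
    obtain ⟨h, hh, e⟩ := hX
    have : h = g := by
      refine Subtype.ext ?_
      rw [e]
      calc v * (star v * (g : Matrix (Fin N) (Fin N) ℂ) * v) * star v =
          (v * star v) * g * (v * star v) := by simp only [Matrix.mul_assoc]
        _ = g := by simp [hv'']
    rwa [← this]
  · exact (Matrix.isUnit_iff_isUnit_det _).2 (Matrix.isUnit_det_of_right_inverse hu1)

end SU

theorem UnitAddTorus.mFourier_coe {d : Type*} [Fintype d] (n : d → ℤ) (θ : d → ℝ) :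
    mFourier n (fun i => (θ i : UnitAddCircle)) =
      Complex.exp (2 * Real.pi * Complex.I * ∑ i, (n i : ℂ) * θ i) := by
  simp only [mFourier, ContinuousMap.coe_mk, fourier_coe_apply]
  rw [← Complex.exp_sum, Finset.mul_sum]
  congr 1
  refine Finset.sum_congr rfl fun i _ => ?_
  push_cast
  ring

theorem UnitAddTorus.mFourier_neg_apply {d : Type*} [Fintype d] (n : d → ℤ)
    (x : UnitAddTorus d) : mFourier n (-x) = star (mFourier n x) := by
  rw [Complex.star_def, ← mFourier_neg]
  simp [mFourier, fourier_apply]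

/-- The character `z ↦ z_i ^ N / ∏ z` of the torus, which is invariant under scalars. -/
def UnitAddTorus.scalarFreeWeight (N : ℕ) (i : Fin N) : Fin N → ℤ :=
  fun j => (if j = i then (N : ℤ) else 0) - 1

namespace SU

variable {N : ℕ} {H : Subgroup (SU N)} {v : Matrix (Fin N) (Fin N) ℂ}

/-- The points of the torus which are mapped into the conjugate of `H` by the diagonal
homomorphism with weights `UnitAddTorus.scalarFreeWeight`. -/
noncomputable def torusSubgroup (H : Subgroup (SU N)) (hv : v ∈ Matrix.unitaryGroup (Fin N) ℂ) :
    AddSubgroup (UnitAddTorus (Fin N)) where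
  carrier := {z | Matrix.diagonal (fun i =>
    UnitAddTorus.mFourier (UnitAddTorus.scalarFreeWeight N i) z) ∈ conjSubmonoid H hv}
  zero_mem' := by
    have : Matrix.diagonal (fun i =>
        UnitAddTorus.mFourier (UnitAddTorus.scalarFreeWeight N i) 0) =
        (1 : Matrix (Fin N) (Fin N) ℂ) := by
      rw [← Matrix.diagonal_one]
      congr 1
      ext i
      simp [UnitAddTorus.mFourier]
    rw [Set.mem_ofPred_eq, this]
    exact one_mem _
  add_mem' := by
    intro x y hx hy
    rw [Set.mem_ofPred_eq] at hx hy
    have := mul_mem hx hy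
    rw [Matrix.diagonal_mul_diagonal] at this
    simpa only [Set.mem_ofPred_eq, UnitAddTorus.mFourier_add_apply] using this
  neg_mem' := by
    intro x hx
    rw [Set.mem_ofPred_eq] at hx
    have := star_mem_conjSubmonoid hx
    rw [Matrix.star_eq_conjTranspose, Matrix.diagonal_conjTranspose] at this
    simp only [Set.mem_ofPred_eq, UnitAddTorus.mFourier_neg_apply]
    exact this

theorem mem_torusSubgroup_coe {hv : v ∈ Matrix.unitaryGroup (Fin N) ℂ} {θ : Fin N → ℝ} :
    (fun i => (θ i : UnitAddCircle)) ∈ torusSubgroup H hv ↔ Matrix.diagonal (fun i =>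
      Complex.exp (2 * Real.pi * Complex.I * (N * θ i - (∑ j, θ j : ℝ)))) ∈ conjSubmonoid H hv := by
  change Matrix.diagonal (fun i => UnitAddTorus.mFourier (UnitAddTorus.scalarFreeWeight N i)
    (fun i => (θ i : UnitAddCircle))) ∈ conjSubmonoid H hv ↔ _
  have : ∀ i : Fin N, ∑ j, (UnitAddTorus.scalarFreeWeight N i j : ℂ) * (θ j : ℂ) =
      N * θ i - (∑ j, θ j : ℝ) := by
    intro i
    simp [UnitAddTorus.scalarFreeWeight, sub_mul]
  simp only [UnitAddTorus.mFourier_coe, this]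

/-- A closed subgroup of `SU(N)` containing an element without nontrivial multiplicative relations
between its eigenvalues contains the maximal torus of that element. -/
theorem torus_le_of_forall_relation_trivial (hH : IsClosed (H : Set (SU N)))
    (hv : v ∈ Matrix.unitaryGroup (Fin N) ℂ) {a : SU N} (ha : a ∈ H) {c₀ : Fin N → ℝ}
    (hc₀ : ∑ i, c₀ i = 0)
    (hav : (a : Matrix (Fin N) (Fin N) ℂ) =
      v * Matrix.diagonal (fun i => Complex.exp (c₀ i * Complex.I)) * star v)
    (hgen : ∀ n : Fin N → ℤ, Complex.exp ((∑ i, n i * c₀ i) * Complex.I) = 1 →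
      ∃ k, ∀ i, n i = k)
    (c : Fin N → ℝ) (hc : ∑ i, c i = 0) : ∃ h ∈ H, (h : Matrix (Fin N) (Fin N) ℂ)
      = v * Matrix.diagonal (fun i => Complex.exp (c i * Complex.I)) * star v := by
  have hpi : (Real.pi : ℂ) ≠ 0 := by exact_mod_cast Real.pi_ne_zero
  have hK : torusSubgroup H hv = ⊤ := by
    refine UnitAddTorus.eq_top_of_forall_mFourier_eq_one _ ?_ fun n hn => ?_
    · exact (isClosed_conjSubmonoid (hv := hv) hH).preimage
        (f := fun z => Matrix.diagonal (fun i =>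
          UnitAddTorus.mFourier (UnitAddTorus.scalarFreeWeight N i) z)) (by fun_prop)
    · have hsum : ∑ i, n i = 0 := by
        by_contra h0
        have h1 := hn (fun _ => (((1 / (2 * ∑ i, n i : ℤ)) : ℝ) : UnitAddCircle))
          (mem_torusSubgroup_coe.2 (by simp [one_mem]))
        have h0' : (∑ i, (n i : ℂ)) ≠ 0 := by exact_mod_cast h0
        rw [UnitAddTorus.mFourier_coe, ← Finset.sum_mul] at h1
        have h2 : 2 * Real.pi * Complex.I * ((∑ i, (n i : ℂ)) *
            ((1 / (2 * ∑ i, n i : ℤ) : ℝ) : ℂ)) = Real.pi * Complex.I := by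
          push_cast
          field_simp
        rw [h2, Complex.exp_pi_mul_I] at h1
        norm_num at h1
      obtain ⟨k, hk⟩ := hgen n (by
        have h1 := hn (fun i => ((c₀ i / (2 * Real.pi) : ℝ) : UnitAddCircle))
          (mem_torusSubgroup_coe.2 (by
            have h2 : Matrix.diagonal (fun i => Complex.exp (c₀ i * Complex.I)) ∈
              conjSubmonoid H hv := ⟨a, ha, hav⟩
            have h3 := pow_mem h2 N
            rw [Matrix.diagonal_pow] at h3
            refine (congrArg (fun f => Matrix.diagonal f ∈ conjSubmonoid H hv) ?_).mp h3
            funext i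
            rw [Pi.pow_apply, ← Complex.exp_nat_mul]
            congr 1
            rw [← Finset.sum_div, hc₀]
            push_cast
            field_simp
            ring))
        rw [UnitAddTorus.mFourier_coe] at h1
        rw [← h1]
        congr 1
        rw [Complex.ofReal_sum, Finset.mul_sum, Finset.sum_mul]
        refine Finset.sum_congr rfl fun i _ => ?_
        push_cast
        field_simp)
      ext i
      simp only [hk, Finset.sum_const, Finset.card_univ, Fintype.card_fin, nsmul_eq_mul,
        mul_eq_zero, Nat.cast_eq_zero] at hsum
      rcases hsum with rfl | rfl
      · exact i.elim0
      · exact hk i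
  have hN : ∀ i : Fin N, (N : ℂ) ≠ 0 := fun i => by exact_mod_cast i.pos.ne'
  have h1 : (fun i => ((c i / (2 * Real.pi * N) : ℝ) : UnitAddCircle)) ∈ torusSubgroup H hv := by
    rw [hK]; trivial
  rw [mem_torusSubgroup_coe] at h1
  obtain ⟨h, hh, e⟩ := h1
  refine ⟨h, hh, ?_⟩
  rw [e]
  congr 3
  ext i
  congr 1
  rw [← Finset.sum_div, hc]
  have := hN i
  push_cast
  field_simp
  ring

end SU

/-- The Kronecker product of the powers `a ^ m i`. -/
def Matrix.kroneckerPow {ι n R : Type*} [Fintype ι] [Fintype n] [DecidableEq n] [CommSemiring R]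
    (m : ι → ℕ) (a : Matrix n n R) : Matrix (ι → n) (ι → n) R :=
  Matrix.of fun j k => ∏ i, (a ^ m i) (j i) (k i)

theorem Matrix.det_kroneckerPow_sub_one_eq_zero {ι n : Type*} [Fintype ι] [DecidableEq ι]
    [Fintype n] [DecidableEq n] {m : ι → ℕ} {a : Matrix n n ℂ} {w : ι → n → ℂ} {l : ι → ℂ}
    (hw : ∀ i, w i ≠ 0) (haw : ∀ i, a.mulVec (w i) = l i • w i) (hl : ∏ i, l i ^ m i = 1) :
    (Matrix.kroneckerPow m a - 1).det = 0 := by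
  refine Matrix.exists_mulVec_eq_zero_iff.1 ⟨fun j => ∏ i, w i (j i), ?_, ?_⟩
  · have : ∀ i, ∃ k, w i k ≠ 0 := fun i => Function.ne_iff.1 (hw i)
    choose k hk using this
    exact Function.ne_iff.2 ⟨k, Finset.prod_ne_zero_iff.2 fun i _ => hk i⟩
  · have hpow : ∀ (i : ι) (r : ℕ), (a ^ r).mulVec (w i) = l i ^ r • w i := by
      intro i r
      induction r with
      | zero => simp
      | succ r ih =>
        rw [pow_succ, ← Matrix.mulVec_mulVec, haw, Matrix.mulVec_smul, ih, smul_smul, pow_succ']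
    rw [Matrix.sub_mulVec, Matrix.one_mulVec, sub_eq_zero]
    ext j
    simp only [Matrix.mulVec, dotProduct, Matrix.kroneckerPow, Matrix.of_apply,
      ← Finset.prod_mul_distrib]
    rw [← Fintype.piFinset_univ]
    refine (Finset.prod_univ_sum (fun _ => Finset.univ)
      (fun i k => (a ^ m i) (j i) k * w i k)).symm.trans ?_
    have : ∀ i, ∑ k, (a ^ m i) (j i) k * w i k = l i ^ m i * w i (j i) := fun i => by
      have := congrFun (hpow i (m i)) (j i)
      simpa [Matrix.mulVec, dotProduct] using this
    simp only [this, Finset.prod_mul_distrib, hl, one_mul]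

theorem Matrix.det_kroneckerPow_diagonal_sub_one {ι n : Type*} [Fintype ι] [DecidableEq ι]
    [Fintype n] [DecidableEq n] (m : ι → ℕ) (l : n → ℂ) :
    (Matrix.kroneckerPow m (Matrix.diagonal l) - 1).det =
      ∏ j : ι → n, (∏ i, l (j i) ^ m i - 1) := by
  have : Matrix.kroneckerPow m (Matrix.diagonal l) - 1 =
      Matrix.diagonal fun j : ι → n => ∏ i, l (j i) ^ m i - 1 := by
    ext j k
    by_cases hjk : j = k
    · subst hjk
      simp [Matrix.kroneckerPow, Matrix.diagonal_pow]
    · obtain ⟨i, hi⟩ := Function.ne_iff.1 hjk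
      rw [Matrix.sub_apply, Matrix.one_apply_ne hjk, Matrix.diagonal_apply_ne _ hjk, sub_zero,
        Matrix.kroneckerPow, Matrix.of_apply]
      refine Finset.prod_eq_zero (Finset.mem_univ i) ?_
      rw [Matrix.diagonal_pow, Matrix.diagonal_apply_ne _ hi]
  rw [this, Matrix.det_diagonal]

theorem Real.exists_linearIndependent_rat (N : ℕ) :
    ∃ x : Fin N → ℝ, LinearIndependent ℚ x := by
  have h : (N : Cardinal) ≤ Module.rank ℚ ℝ := by
    rw [Real.rank_rat_real]
    exact (Cardinal.natCast_lt_aleph0.trans Cardinal.aleph0_lt_continuum).le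
  obtain ⟨s, hs, hli⟩ := exists_finset_linearIndependent_of_le_rank h
  let e : Fin N ≃ s := (Fin.castOrderIso hs.symm).toEquiv.trans s.equivFin.symm
  exact ⟨fun i => (e i : ℝ), hli.comp e e.injective⟩

/-- There are trace zero real vectors `c` for which no combination `∑ m i * c (j i)` with given
positive nonconstant multiplicities vanishes. -/
theorem exists_sum_eq_zero_forall_sum_ne_zero {N : ℕ} {m : Fin N → ℕ} (hpos : ∀ i, 0 < m i)
    (hm : ¬ ∃ k, ∀ i, m i = k) :
    ∃ c : Fin N → ℝ, ∑ i, c i = 0 ∧ ∀ j : Fin N → Fin N, ∑ i, m i * c (j i) ≠ 0 := by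
  obtain ⟨x, hx⟩ := Real.exists_linearIndependent_rat N
  refine ⟨fun l => N * x l - ∑ k, x k, ?_, fun j hj => hm ?_⟩
  · rw [Finset.sum_sub_distrib, ← Finset.mul_sum]
    simp
  · let r : Fin N → ℕ := fun l => ∑ i, if j i = l then m i else 0
    have hr : ∑ l, ((N * r l - ∑ i, m i : ℚ)) • x l = 0 := by
      rw [← hj]
      simp only [mul_sub, Finset.sum_sub_distrib, sub_smul, Rat.smul_def]
      congr 1
      · push_cast
        simp only [r]
        push_cast
        simp only [Finset.mul_sum, Finset.sum_mul]
        rw [Finset.sum_comm]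
        refine Finset.sum_congr rfl fun i _ => ?_
        rw [Finset.sum_eq_single (j i)]
        · simp; ring
        · intro l _ hl; simp [Ne.symm hl]
        · simp
      · push_cast
        rw [← Finset.mul_sum, Finset.sum_mul]
    have h1 := Fintype.linearIndependent_iff.1 hx _ hr
    have h2 : ∀ l, N * r l = ∑ i, m i := fun l => by
      have := sub_eq_zero.1 (h1 l)
      exact_mod_cast this
    have hN : ∀ l l', r l = r l' := fun l l' =>
      Nat.eq_of_mul_eq_mul_left l.pos ((h2 l).trans (h2 l').symm)
    have hsurj : Function.Surjective j := by
      intro l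
      by_contra hl
      push Not at hl
      have h0 : r l = 0 := by simp [r, hl]
      have h3 : m l ≤ r (j l) := by
        have := Finset.single_le_sum (f := fun i => if j i = j l then m i else 0)
          (fun _ _ => Nat.zero_le _) (Finset.mem_univ l)
        simpa using this
      have := hpos l
      have := hN l (j l)
      omega
    have hinj := Finite.injective_iff_surjective.2 hsurj
    have h4 : ∀ i, r (j i) = m i := fun i => by simp [r, hinj.eq_iff]
    rcases isEmpty_or_nonempty (Fin N) with he | ⟨⟨i₀⟩⟩
    · exact ⟨0, fun i => he.elim i⟩
    · exact ⟨r i₀, fun i => by rw [← h4]; exact hN _ _⟩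

section analytic

variable {n : Type*} {t : ℝ}

theorem AnalyticAt.matrix_mul_apply [Fintype n] {A B : ℝ → Matrix n n ℂ}
    (hA : ∀ i j, AnalyticAt ℝ (fun s => A s i j) t) (hB : ∀ i j, AnalyticAt ℝ (fun s => B s i j) t)
    (i j : n) : AnalyticAt ℝ (fun s => (A s * B s) i j) t := by
  simp only [Matrix.mul_apply]
  exact Finset.analyticAt_fun_sum _ fun k _ => (hA _ _).mul (hB _ _)

theorem AnalyticAt.matrix_pow_apply [Fintype n] [DecidableEq n] {A : ℝ → Matrix n n ℂ}
    (hA : ∀ i j, AnalyticAt ℝ (fun s => A s i j) t) (m : ℕ) (i j : n) :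
    AnalyticAt ℝ (fun s => (A s ^ m) i j) t := by
  induction m generalizing i j with
  | zero => simpa using analyticAt_const
  | succ m ih =>
    simp only [pow_succ]
    exact AnalyticAt.matrix_mul_apply ih hA i j

theorem AnalyticAt.matrix_star_apply {A : ℝ → Matrix n n ℂ}
    (hA : ∀ i j, AnalyticAt ℝ (fun s => A s i j) t) (i j : n) :
    AnalyticAt ℝ (fun s => (star (A s)) i j) t := by
  simp only [Matrix.star_apply]
  exact (Complex.conjCLE.toContinuousLinearMap.analyticAt _).comp (hA j i)

theorem AnalyticAt.matrix_det [Fintype n] [DecidableEq n] {A : ℝ → Matrix n n ℂ}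
    (hA : ∀ i j, AnalyticAt ℝ (fun s => A s i j) t) : AnalyticAt ℝ (fun s => (A s).det) t := by
  simp only [Matrix.det_apply']
  exact Finset.analyticAt_fun_sum _ fun σ _ =>
    analyticAt_const.mul (Finset.analyticAt_fun_prod _ fun i _ => hA _ _)

end analytic

namespace SU

variable {N : ℕ}

/-- Diagonal elements of `SU(N)`. -/
noncomputable def diagonal (c : Fin N → ℝ) (hc : ∑ i, c i = 0) : SU N :=
  ⟨Matrix.diagonal fun i => Complex.exp (c i * Complex.I), by
    rw [Matrix.mem_specialUnitaryGroup_iff, Matrix.mem_unitaryGroup_iff]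
    constructor
    · rw [Matrix.star_eq_conjTranspose, Matrix.diagonal_conjTranspose, Matrix.diagonal_mul_diagonal,
        ← Matrix.diagonal_one]
      congr 1
      ext i
      simp [← Complex.exp_conj, ← Complex.exp_add]
    · rw [Matrix.det_diagonal, ← Complex.exp_sum, ← Finset.sum_mul, ← Complex.ofReal_sum, hc]
      simp⟩

theorem ae_haar_det_kroneckerPow_sub_one_ne_zero {m : Fin N → ℕ} (hpos : ∀ i, 0 < m i)
    (hm : ¬ ∃ k, ∀ i, m i = k) : ∀ᵐ (a : SU N) ∂(Measure.haar : Measure (SU N)),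
      (Matrix.kroneckerPow m (a : Matrix (Fin N) (Fin N) ℂ) - 1).det ≠ 0 := by
  obtain ⟨c, hc, hne⟩ := exists_sum_eq_zero_forall_sum_ne_zero hpos hm
  let B : ℝ := 1 + ∑ j : Fin N → Fin N, |∑ i, m i * c (j i)|
  have hB : ∀ j : Fin N → Fin N, |∑ i, m i * c (j i)| < B := fun j => by
    have := Finset.single_le_sum (f := fun j : Fin N → Fin N => |∑ i, m i * c (j i)|)
      (fun _ _ => abs_nonneg _) (Finset.mem_univ j)
    simp only [B]
    linarith
  have hB0 : 0 < B := by
    have : 0 ≤ ∑ j : Fin N → Fin N, |∑ i, m i * c (j i)| :=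
      Finset.sum_nonneg fun _ _ => abs_nonneg _
    simp only [B]
    linarith
  refine SU.ae_haar_ne_zero (f := fun a : SU N =>
    (Matrix.kroneckerPow m (a : Matrix (Fin N) (Fin N) ℂ) - 1).det) ?_ ?_
    (g₀ := SU.diagonal (fun i => c i / B) (by rw [← Finset.sum_div, hc, zero_div])) ?_
  · refine Continuous.matrix_det (Continuous.sub (continuous_matrix fun j k => ?_) continuous_const)
    simp only [Matrix.kroneckerPow, Matrix.of_apply]
    exact continuous_finsetProd _ fun i _ =>
      (continuous_subtype_val.pow _).matrix_elem _ _
  · intro γ hγ t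
    refine AnalyticAt.matrix_det fun j k => ?_
    simp only [Matrix.sub_apply, Matrix.kroneckerPow, Matrix.of_apply]
    exact (Finset.analyticAt_fun_prod _ fun i _ =>
      AnalyticAt.matrix_pow_apply (fun i j => hγ i j t) _ _ _).sub analyticAt_const
  · simp only [SU.diagonal, Matrix.det_kroneckerPow_diagonal_sub_one]
    refine Finset.prod_ne_zero_iff.2 fun j _ h => hne j ?_
    rw [sub_eq_zero] at h
    simp only [← Complex.exp_nat_mul] at h
    rw [← Complex.exp_sum, Complex.exp_eq_one_iff] at h
    obtain ⟨k, hk⟩ := h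
    have h1 : (∑ i, m i * c (j i)) / B = k * (2 * Real.pi) := by
      have : ((((∑ i, m i * c (j i)) / B : ℝ)) : ℂ) = ((k * (2 * Real.pi) : ℝ) : ℂ) := by
        apply mul_right_cancel₀ Complex.I_ne_zero
        push_cast
        rw [mul_assoc (k : ℂ), ← hk, Finset.sum_div, Finset.sum_mul]
        refine Finset.sum_congr rfl fun i _ => ?_
        push_cast
        ring
      exact_mod_cast this
    have h2 : |(∑ i, m i * c (j i)) / B| < 1 := by
      rw [abs_div, abs_of_pos hB0, div_lt_one hB0]
      exact hB j
    have hk0 : k = 0 := by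
      by_contra hk0
      have h3 : (1 : ℝ) ≤ |(k : ℝ)| := by exact_mod_cast Int.one_le_abs hk0
      rw [h1, abs_mul, abs_of_pos (by positivity : 0 < 2 * Real.pi)] at h2
      have := Real.pi_gt_three
      nlinarith
    rw [hk0, Int.cast_zero, zero_mul, div_eq_zero_iff] at h1
    exact h1.resolve_right hB0.ne'

theorem forall_relation_trivial {a : SU N} (ha : ∀ m : Fin N → ℕ, (∀ i, 0 < m i) →
      (¬ ∃ k, ∀ i, m i = k) →
      (Matrix.kroneckerPow m (a : Matrix (Fin N) (Fin N) ℂ) - 1).det ≠ 0)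
    {v : Matrix (Fin N) (Fin N) ℂ} (hv : v ∈ Matrix.unitaryGroup (Fin N) ℂ) {c : Fin N → ℝ}
    (hc : ∑ i, c i = 0) (hav : (a : Matrix (Fin N) (Fin N) ℂ) =
      v * Matrix.diagonal (fun i => Complex.exp (c i * Complex.I)) * star v)
    (n : Fin N → ℤ) (hn : Complex.exp ((∑ i, n i * c i : ℝ) * Complex.I) = 1) :
    ∃ k, ∀ i, n i = k := by
  by_contra hconst
  let M : ℤ := 1 + ∑ i, |n i|
  have hM : ∀ i, 0 < n i + M := fun i => by
    have h1 := Finset.single_le_sum (f := fun i => |n i|) (fun _ _ => abs_nonneg _)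
      (Finset.mem_univ i)
    have h2 := neg_abs_le (n i)
    simp only [M]
    omega
  have hcast : ∀ i, (((n i + M).toNat : ℤ)) = n i + M := fun i => Int.toNat_of_nonneg (hM i).le
  refine ha (fun i => (n i + M).toNat) (fun i => by have := hM i; omega) ?_ ?_
  · rintro ⟨k, hk⟩
    refine hconst ⟨k - M, fun i => ?_⟩
    have := hcast i
    rw [hk] at this
    omega
  · have hv' := Matrix.mem_unitaryGroup_iff'.1 hv
    refine Matrix.det_kroneckerPow_sub_one_eq_zero (w := fun i k => v k i)
      (l := fun i => Complex.exp (c i * Complex.I)) (fun i h => ?_) (fun i => ?_) ?_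
    · have := congrFun (congrFun hv' i) i
      rw [Matrix.mul_apply] at this
      simp [fun k => congrFun h k] at this
    · have hw : (fun k => v k i) = v.mulVec (Pi.single i 1) := by
        rw [Matrix.mulVec_single_one]; rfl
      rw [hw, hav, Matrix.mulVec_mulVec, Matrix.mul_assoc _ (star v) v, hv', Matrix.mul_one,
        ← Matrix.mulVec_mulVec, ← Matrix.mulVec_smul]
      congr 1
      ext k
      by_cases h : k = i <;> simp [Matrix.mulVec_diagonal, h]
    · simp only [← Complex.exp_nat_mul]
      rw [← Complex.exp_sum, ← hn]
      congr 1
      have : ∀ i, (((n i + M).toNat : ℕ) : ℂ) = n i + M := fun i => by exact_mod_cast hcast i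
      simp only [this]
      rw [Complex.ofReal_sum, Finset.sum_mul]
      have h2 : ∑ i, (c i : ℂ) = 0 := by exact_mod_cast hc
      have h3 : ∑ i, (M : ℂ) * (c i * Complex.I) = 0 := by
        rw [← Finset.mul_sum, ← Finset.sum_mul, h2]; simp
      simp only [add_mul, Finset.sum_add_distrib, h3, add_zero]
      refine Finset.sum_congr rfl fun i _ => ?_
      push_cast
      ring

/-- For `i ≠ j` there are a trace zero real vector `c` and `β ∈ SU(N)` such that `β * c * β⁻¹` has
a nonzero `(i, j)` entry. -/
theorem exists_conj_diagonal_apply_ne_zero {i j : Fin N} (hij : i ≠ j) :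
    ∃ c : Fin N → ℝ, ∑ i, c i = 0 ∧ ∃ β : SU N,
      ((β : Matrix (Fin N) (Fin N) ℂ) * Matrix.diagonal (fun i => (c i : ℂ)) *
        star (β : Matrix (Fin N) (Fin N) ℂ)) i j ≠ 0 := by
  let X : Matrix (Fin N) (Fin N) ℂ := Matrix.single i j 1 + Matrix.single j i 1
  have hX : X.IsHermitian := by
    simp [X, Matrix.IsHermitian, Matrix.conjTranspose_add, Matrix.conjTranspose_single, add_comm]
  have hXij : X i j = 1 := by simp [X, hij]
  let w : Matrix (Fin N) (Fin N) ℂ := hX.eigenvectorUnitary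
  have hw : w ∈ Matrix.unitaryGroup (Fin N) ℂ := hX.eigenvectorUnitary.2
  have hspec : X = w * Matrix.diagonal (fun i => (hX.eigenvalues i : ℂ)) * star w :=
    hX.spectral_theorem
  have hNpos : 0 < N := i.pos
  have hdet : ‖w.det‖ = 1 := by
    have := congrArg Matrix.det (Matrix.mem_unitaryGroup_iff.1 hw)
    rw [Matrix.det_mul, Matrix.star_eq_conjTranspose, Matrix.det_conjTranspose, Matrix.det_one,
      Complex.star_def, Complex.mul_conj, Complex.normSq_eq_norm_sq] at this
    have h2 : ‖w.det‖ ^ 2 = 1 := by exact_mod_cast this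
    exact (pow_eq_one_iff_of_nonneg (norm_nonneg _) two_ne_zero).1 h2
  obtain ⟨s, hs⟩ := IsAlgClosed.exists_pow_nat_eq (w.det)⁻¹ hNpos
  have hs1 : ‖s‖ = 1 := by
    have := congrArg norm hs
    rw [norm_pow, norm_inv, hdet, inv_one] at this
    exact (pow_eq_one_iff_of_nonneg (norm_nonneg _) hNpos.ne').1 this
  have hss : s * star s = 1 := by
    rw [Complex.star_def, Complex.mul_conj, Complex.normSq_eq_norm_sq, hs1]; simp
  refine ⟨hX.eigenvalues, ?_, ⟨s • w, ?_⟩, ?_⟩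
  · have h1 := hX.trace_eq_sum_eigenvalues
    have h2 : X.trace = 0 := by
      simp [X, hij, hij.symm]
    rw [h2] at h1
    rw [← RCLike.ofReal_sum] at h1
    exact RCLike.ofReal_eq_zero.1 h1.symm
  · rw [Matrix.mem_specialUnitaryGroup_iff, Matrix.mem_unitaryGroup_iff]
    constructor
    · rw [star_smul, Matrix.smul_mul, Matrix.mul_smul, smul_smul, hss,
        Matrix.mem_unitaryGroup_iff.1 hw, one_smul]
    · rw [Matrix.det_smul, Fintype.card_fin, hs, inv_mul_cancel₀]
      exact norm_ne_zero_iff.1 (by rw [hdet]; norm_num)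
  · have : s • w * Matrix.diagonal (fun i => (hX.eigenvalues i : ℂ)) * star (s • w) = X := by
      rw [star_smul, Matrix.smul_mul, Matrix.smul_mul, Matrix.mul_smul, smul_smul, hss, one_smul,
        ← hspec]
    rw [this, hXij]
    exact one_ne_zero

theorem ae_haar_exists_conj_diagonal_apply_ne_zero {v : Matrix (Fin N) (Fin N) ℂ}
    (hv : v ∈ Matrix.unitaryGroup (Fin N) ℂ) :
    ∀ᵐ (b : SU N) ∂(Measure.haar : Measure (SU N)), ∀ i j, i ≠ j → ∃ c : Fin N → ℝ, ∑ i, c i = 0 ∧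
      (star v * (b : Matrix (Fin N) (Fin N) ℂ) * v * Matrix.diagonal (fun i => (c i : ℂ)) *
        star (star v * (b : Matrix (Fin N) (Fin N) ℂ) * v)) i j ≠ 0 := by
  rw [ae_all_iff]; intro i
  rw [ae_all_iff]; intro j
  by_cases hij : i = j
  · exact Filter.Eventually.of_forall fun _ h => (h hij).elim
  obtain ⟨c, hc, β, hβ⟩ := exists_conj_diagonal_apply_ne_zero hij
  have hv' := Matrix.mem_unitaryGroup_iff'.1 hv
  have hv'' := Matrix.mem_unitaryGroup_iff.1 hv
  have hmem : v * (β : Matrix (Fin N) (Fin N) ℂ) * star v ∈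
      Matrix.specialUnitaryGroup (Fin N) ℂ := by
    rw [Matrix.mem_specialUnitaryGroup_iff]
    refine ⟨mul_mem (mul_mem hv (Matrix.mem_specialUnitaryGroup_iff.1 β.2).1)
      (Unitary.star_mem hv), ?_⟩
    rw [Matrix.det_mul, Matrix.det_mul, (Matrix.mem_specialUnitaryGroup_iff.1 β.2).2, mul_one,
      ← Matrix.det_mul, hv'', Matrix.det_one]
  have := SU.ae_haar_ne_zero (f := fun b : SU N =>
    (star v * (b : Matrix (Fin N) (Fin N) ℂ) * v * Matrix.diagonal (fun i => (c i : ℂ)) *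
        star (star v * (b : Matrix (Fin N) (Fin N) ℂ) * v)) i j) (g₀ := ⟨_, hmem⟩) ?_ ?_ ?_
  · filter_upwards [this] with b hb _
    exact ⟨c, hc, hb⟩
  · exact Continuous.matrix_elem (by fun_prop) _ _
  · intro γ hγ t
    have hconst : ∀ (A : Matrix (Fin N) (Fin N) ℂ) i j, AnalyticAt ℝ (fun _ : ℝ => A i j) t :=
      fun A i j => analyticAt_const
    have h1 := AnalyticAt.matrix_mul_apply (AnalyticAt.matrix_mul_apply (hconst (star v))
      fun i j => hγ i j t) (hconst v)
    exact AnalyticAt.matrix_mul_apply (AnalyticAt.matrix_mul_apply h1 (hconst _))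
      (AnalyticAt.matrix_star_apply h1) i j
  · have : star v * (v * (β : Matrix (Fin N) (Fin N) ℂ) * star v) * v = β := by
      calc _ = (star v * v) * (β : Matrix (Fin N) (Fin N) ℂ) * (star v * v) := by
            simp only [Matrix.mul_assoc]
        _ = β := by simp [hv']
    simp only [this]
    exact hβ

end SU

theorem closure_pair_subset_wordSet {G : Type*} [Group G] (a b : G) :
    (Subgroup.closure {a, b} : Set G) ⊆ wordSet a b := by
  have hcons : ∀ (p q : ℤ) {g : G}, g ∈ wordSet a b → a ^ p * b ^ q * g ∈ wordSet a b := by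
    rintro p q _ ⟨k, P, Q, rfl⟩
    exact ⟨k + 1, Fin.cons p P, Fin.cons q Q, by simp [List.ofFn_succ]⟩
  intro g hg
  induction hg using Subgroup.closure_induction_left with
  | one => exact ⟨0, 0, 0, by simp⟩
  | mul_left x hx y hy ih =>
    rcases hx with rfl | rfl
    · simpa using hcons 1 0 ih
    · simpa using hcons 0 1 ih
  | inv_mul_cancel x hx y hy ih =>
    rcases hx with rfl | rfl
    · simpa using hcons (-1) 0 ih
    · simpa using hcons 0 (-1) ih

theorem measurableSet_dense_wordSet (G : Type*) [Group G] [TopologicalSpace G]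
    [IsTopologicalGroup G] [SecondCountableTopology G] [MeasurableSpace G] [BorelSpace G] :
    MeasurableSet {p : G × G | Dense (wordSet p.1 p.2)} := by
  have hB := TopologicalSpace.isBasis_countableBasis G
  have : {p : G × G | Dense (wordSet p.1 p.2)} =
      ⋂ U ∈ TopologicalSpace.countableBasis G, ⋃ k : ℕ, ⋃ P : Fin k → ℤ, ⋃ Q : Fin k → ℤ,
        {p : G × G | (List.ofFn fun i => p.1 ^ P i * p.2 ^ Q i).prod ∈ U} := by
    ext p
    simp only [Set.mem_ofPred_eq, Set.mem_iInter, Set.mem_iUnion, hB.dense_iff]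
    constructor
    · intro h U hU
      obtain ⟨g, hgU, k, P, Q, rfl⟩ := h U hU (TopologicalSpace.nonempty_of_mem_countableBasis hU)
      exact ⟨k, P, Q, hgU⟩
    · intro h U hU _
      obtain ⟨k, P, Q, hmem⟩ := h U hU
      exact ⟨_, hmem, k, P, Q, rfl⟩
  rw [this]
  refine MeasurableSet.biInter (TopologicalSpace.countable_countableBasis G) fun U hU =>
    MeasurableSet.iUnion fun k => MeasurableSet.iUnion fun P => MeasurableSet.iUnion fun Q => ?_
  refine ((hB.isOpen hU).preimage (f := fun p : G × G =>
    (List.ofFn fun i => p.1 ^ P i * p.2 ^ Q i).prod) ?_).measurableSet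
  simp only [List.ofFn_eq_map]
  exact continuous_list_prod _ fun i _ => by fun_prop

/-- Almost every pair of elements of `SU(N)` generates a dense subgroup. -/
theorem SU.ae_haar_ae_haar_dense_wordSet (N : ℕ) :
    ∀ᵐ a ∂(Measure.haar : Measure (SU N)), ∀ᵐ b ∂(Measure.haar : Measure (SU N)),
      Dense (wordSet a b) := by
  have h1 : ∀ᵐ (a : SU N) ∂(Measure.haar : Measure (SU N)), ∀ m : Fin N → ℕ, (∀ i, 0 < m i) →
      (¬ ∃ k, ∀ i, m i = k) →
      (Matrix.kroneckerPow m (a : Matrix (Fin N) (Fin N) ℂ) - 1).det ≠ 0 := by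
    rw [ae_all_iff]; intro m
    by_cases hpos : ∀ i, 0 < m i
    · by_cases hm : ∃ k, ∀ i, m i = k
      · exact Filter.Eventually.of_forall fun _ _ h => (h hm).elim
      · filter_upwards [ae_haar_det_kroneckerPow_sub_one_ne_zero hpos hm] with a ha _ _
        exact ha
    · exact Filter.Eventually.of_forall fun _ h => (hpos h).elim
  filter_upwards [h1] with a ha
  obtain ⟨v, hv, c, hc, hav⟩ := SU.exists_diagonal a
  filter_upwards [ae_haar_exists_conj_diagonal_apply_ne_zero hv] with b hb
  let H : Subgroup (SU N) := (Subgroup.closure {a, b}).topologicalClosure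
  have hcl : IsClosed (H : Set (SU N)) := Subgroup.isClosed_topologicalClosure _
  have haH : a ∈ H := Subgroup.le_topologicalClosure _ (Subgroup.subset_closure (by simp))
  have hbH : b ∈ H := Subgroup.le_topologicalClosure _ (Subgroup.subset_closure (by simp))
  have htop : H = ⊤ := SU.eq_top_of_torus_le hcl hv
    (SU.torus_le_of_forall_relation_trivial hcl hv haH hc hav
      (SU.forall_relation_trivial ha hv hc hav)) hbH hb
  have hdense : Dense (Subgroup.closure {a, b} : Set (SU N)) := by
    rw [dense_iff_closure_eq, ← Subgroup.topologicalClosure_coe]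
    change (H : Set (SU N)) = _
    rw [htop]
    rfl
  exact hdense.mono (closure_pair_subset_wordSet a b)

theorem theorem1 (N : ℕ) {Ω : Type*} [MeasurableSpace Ω] (P : Measure Ω) [IsProbabilityMeasure P]
    (R₁ R₂ : Ω → SU N) (hR₁ : Measurable R₁) (hR₂ : Measurable R₂)
    (hindep : ProbabilityTheory.IndepFun R₁ R₂ P)
    (hsupp₁ : (P.map R₁).support = Set.univ) (hsupp₂ : (P.map R₂).support = Set.univ)
    (hac₁ : P.map R₁ ≪ Measure.haar) (hac₂ : P.map R₂ ≪ Measure.haar) :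
    ∀ᵐ ω ∂P, Dense (wordSet (R₁ ω) (R₂ ω)) := by
  have hmeas := measurableSet_dense_wordSet (SU N)
  have hprob₁ := Measure.isProbabilityMeasure_map (μ := P) hR₁.aemeasurable
  have hprob₂ := Measure.isProbabilityMeasure_map (μ := P) hR₂.aemeasurable
  have h1 : ∀ᵐ p ∂((P.map R₁).prod (P.map R₂)), Dense (wordSet p.1 p.2) := by
    rw [Measure.ae_prod_iff_ae_ae hmeas]
    filter_upwards [hac₁.ae_le (SU.ae_haar_ae_haar_dense_wordSet N)] with a ha
    exact hac₂.ae_le ha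
  rw [← (ProbabilityTheory.indepFun_iff_map_prod_eq_prod_map_map hR₁.aemeasurable
    hR₂.aemeasurable).1 hindep] at h1
  exact (ae_map_iff (hR₁.prodMk hR₂).aemeasurable hmeas).1 h1
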